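/- **Setting.** Let $n>2$ and let $\sigma:\mathbb R\to\mathbb R$ be continuous and not a polynomial. For a finite $G$-set $X$, the group $G$ acts on $\mathbb R^X$ by $g e_x=e_{gx}$; $\mathrm{Aff}_G(V,W)$ is the space of $G$-equivariant affine maps. Let $\mathbb Z_n$ and $S_n$ act on $[n]$ by cyclic shifts and by permutations, trivially on $\mathbb R$, and let $S_n$ act on itself by left multiplication. For a space $M$ of affine maps $V\to\mathbb R^Y$ and a space $N$ of affine maps $\mathbb R^Y\to Z$, let $\mathcal N(M,N)\subseteq C(V,Z)$ be the set of all shallow networks $x\mapsto\sum_{j=1}^h g_j(\sigma(f_j(x)))$ with $h\in\mathbb N$, $f_j\in M$, $g_j\in N$ and $\sigma$ applied coordinatewise, and let $\mathcal U(M,N)$ be its closure in $C(V,Z)$ for uniform convergence on compact sets. Write $\mathcal U(V,W,Z)=\mathcal U(\mathrm{Aff}_{S_n}(V,W),\mathrm{Aff}_{S_n}(W,Z))$. Let $C^k$ be the space of maps $v\mapsto\sum_{i=1}^k x_iA(e_i)v+y\mathbb 1$ on $\mathbb R^n$, where $A(x)$ is the circulant matrix with first column $x$ (so $C^1=\{v\mapsto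 xv+y\mathbb 1\}$), and let $I=\mathrm{Aff}_{\mathbb Z_n}(\mathbb R^n,\mathbb R)$. For a family $\mathcal N$ of maps, $\rho(\mathcal N)$ is the set of pairs $(\alpha,\beta)$ with $f(\alpha)=f(\beta)$ for all $f\in\mathcal N$. A family $\mathcal N\subseteq C(V,Z)$ is *separation-constrained universal* if its closure is the set of all continuous functions (for a family of $G$-equivariant maps: of all continuous $G$-equivariant maps) $V\to Z$ that respect $\rho(\mathcal N)$. **Proposition.** 1. (Invariant models.) The classes $\mathcal U(C^1,I)$, $\mathcal U(\mathbb R^n,\mathbb R^n,\mathbb R)$ and $\mathcal U(\mathbb R^n,\mathbb R^{S_n},\mathbb R)$ have the same separation relation $\rho$, and $$\mathcal U(C^1,I)\subsetneq\mathcal U(\mathbb R^n,\mathbb R^n,\mathbb R)\subsetneq\mathcal U(\mathbb R^n,\mathbb R^{S_n},\mathbb R).$$ The function $(x_1+\dots+x_n)^n$ belongs to the second class and not to the first. If $n>3$, the function $x_1\cdots x_n$ belongs to the third class and not to the second. Neither the width-1 CNNs $\mathcal N(C^1,I)$ nor the shallow PointNets $\mathcal N(\mathrm{Aff}_{S_n}(\mathbb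 R^n,\mathbb R^n),\mathrm{Aff}_{S_n}(\mathbb R^n,\mathbb R))$ are separation-constrained universal. 2. (Equivariant models with output $\mathbb R^n$.) The classes $\mathcal U(C^1,C^1)$, $\mathcal U(\mathbb R^n,\mathbb R^n,\mathbb R^n)$ and $\mathcal U(\mathbb R^n,\mathbb R^{S_n},\mathbb R^n)$ have the same separation relation, and $$\mathcal U(C^1,C^1)\subsetneq\mathcal U(\mathbb R^n,\mathbb R^n,\mathbb R^n)\subsetneq\mathcal U(\mathbb R^n,\mathbb R^{S_n},\mathbb R^n).$$ For no $1\le k\le n$ is the family $\mathcal N(C^1,C^k)$ of $\mathbb Z_n$-equivariant maps separation-constrained universal. 3. (Equivariant models with arbitrary output.) For every nonempty finite $S_n$-set $Y$, $$\mathcal U(C^1,\mathrm{Aff}_{S_n}(\mathbb R^n,\mathbb R^Y))\subsetneq\mathcal U(\mathbb R^n,\mathbb R^n,\mathbb R^Y)\subsetneq\mathcal U(\mathbb R^n,\mathbb R^{S_n},\mathbb R^Y),$$ and neither of the families of $S_n$-equivariant maps $\mathcal N(C^1,\mathrm{Aff}_{S_n}(\mathbb R^n,\mathbb R^Y))$ and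 $\mathcal N(\mathrm{Aff}_{S_n}(\mathbb R^n,\mathbb R^n),\mathrm{Aff}_{S_n}(\mathbb R^n,\mathbb R^Y))$ is separation-constrained universal. -/

import Mathlib

open scoped BigOperators

namespace EquivariantNetworks

/-- The permutation representation of `G` on `ℝ^X = (X → ℝ)`: `g • e_x = e_{g x}`,
that is, `(g • v) x = v (g⁻¹ x)`. -/
def permRep (G X : Type*) [Group G] [MulAction G X] : Representation ℝ G (X → ℝ) where
  toFun g := LinearMap.funLeft ℝ ℝ (fun x : X => g⁻¹ • x)
  map_one' := by
    ext v x
    simp [LinearMap.funLeft]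
  map_mul' g h := by
    ext v x
    simp [LinearMap.funLeft, mul_smul]

/-- `Aff_G(V, Z)`: the space of `G`-equivariant affine maps between two representations. -/
def equivAff {G V Z : Type*} [Group G] [AddCommGroup V] [Module ℝ V]
    [AddCommGroup Z] [Module ℝ Z] (ρ : Representation ℝ G V) (τ : Representation ℝ G Z) :
    Submodule ℝ (V →ᵃ[ℝ] Z) where
  carrier := {f | ∀ (g : G) (v : V), f (ρ g v) = τ g (f v)}
  zero_mem' := by
    intro g v
    simp
  add_mem' := by
    intro a b ha hb g v
    simp [ha g v, hb g v]
  smul_mem' := by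
    intro c a ha g v
    simp [ha g v]

/-- The point-wise activation `ℝ^X → ℝ^X` induced by `σ : ℝ → ℝ`. -/
def pointwise (σ : ℝ → ℝ) {X : Type*} (v : X → ℝ) : X → ℝ := fun x => σ (v x)

/-- `N_σ(M¹, M²)`: the shallow neural networks with layers in `M¹`, `M²` and activation `σ`. -/
def shallowNeuralSpace (σ : ℝ → ℝ) {V X Z : Type*} [AddCommGroup V] [Module ℝ V]
    [AddCommGroup Z] [Module ℝ Z]
    (M₁ : Set (V →ᵃ[ℝ] (X → ℝ))) (M₂ : Set ((X → ℝ) →ᵃ[ℝ] Z)) : Set (V → Z) :=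
  {F | ∃ φ ∈ M₂, ∃ η ∈ M₁, F = φ ∘ pointwise σ ∘ η}

/-- `M_h = {x ↦ (f₁ x, …, f_h x) | f_j ∈ M}`, where `ℝ^Y ⊗ ℝ^h` is realised as `ℝ^(Y × [h])`. -/
def widen {V Y : Type*} [AddCommGroup V] [Module ℝ V]
    (M : Submodule ℝ (V →ᵃ[ℝ] (Y → ℝ))) (h : ℕ) : Set (V →ᵃ[ℝ] (Y × Fin h → ℝ)) :=
  {F | ∃ f : Fin h → (V →ᵃ[ℝ] (Y → ℝ)), (∀ j, f j ∈ M) ∧ ∀ v y j, F v (y, j) = f j v y}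

/-- `_hN = {(x₁, …, x_h) ↦ g₁ x₁ + ⋯ + g_h x_h | g_j ∈ N}`. -/
def pool {Y Z : Type*} [AddCommGroup Z] [Module ℝ Z]
    (N : Submodule ℝ ((Y → ℝ) →ᵃ[ℝ] Z)) (h : ℕ) : Set ((Y × Fin h → ℝ) →ᵃ[ℝ] Z) :=
  {F | ∃ g : Fin h → ((Y → ℝ) →ᵃ[ℝ] Z), (∀ j, g j ∈ N) ∧
    ∀ w, F w = ∑ j, g j (fun y => w (y, j))}

section Classes

variable {V Y Z : Type*} [AddCommGroup V] [Module ℝ V] [TopologicalSpace V]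
  [AddCommGroup Z] [Module ℝ Z] [TopologicalSpace Z]

/-- The union over all widths `h` of the neural spaces `N_σ(M_h, _hN)`, inside `C(V, Z)`. -/
def networks (σ : ℝ → ℝ) (M : Submodule ℝ (V →ᵃ[ℝ] (Y → ℝ)))
    (N : Submodule ℝ ((Y → ℝ) →ᵃ[ℝ] Z)) : Set C(V, Z) :=
  {F | ∃ h : ℕ, (F : V → Z) ∈ shallowNeuralSpace σ (widen M h) (pool N h)}

/-- The universality class `U(M, N)`: the closure of the networks of all widths in `C(V, Z)`.
The topology of `C(V, Z)` is the compact-open one, i.e. uniform convergence on compact sets. -/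
def universalityClass (σ : ℝ → ℝ) (M : Submodule ℝ (V →ᵃ[ℝ] (Y → ℝ)))
    (N : Submodule ℝ ((Y → ℝ) →ᵃ[ℝ] Z)) : Set C(V, Z) :=
  closure (networks σ M N)

end Classes

section Separation

variable {X Z : Type*} [TopologicalSpace X] [TopologicalSpace Z]

/-- `ρ(𝒩)`: the pairs of points that no member of the family `𝒩` separates. -/
def sepRel (𝒩 : Set C(X, Z)) : Set (X × X) :=
  {p | ∀ f ∈ 𝒩, f p.1 = f p.2}

/-- `C_ρ`: the continuous functions that respect the relation `ρ`. -/
def respecting (R : Set (X × X)) : Set C(X, Z) :=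
  {f | ∀ p ∈ R, f p.1 = f p.2}

/-- Separation-constrained universality of the family `𝒩`: its closure is the set of all
continuous functions that respect `ρ(𝒩)`. -/
def IsSepUniversal (𝒩 : Set C(X, Z)) : Prop :=
  closure 𝒩 = respecting (sepRel 𝒩)

/-- Separation-constrained universality of a family of equivariant maps: its closure is the set of
all continuous equivariant maps that respect `ρ(𝒩)`. -/
def IsEquivSepUniversal {G V W : Type*} [Group G] [AddCommGroup V] [Module ℝ V]
    [TopologicalSpace V] [AddCommGroup W] [Module ℝ W] [TopologicalSpace W]
    (ρ : Representation ℝ G V) (τ : Representation ℝ G W) (𝒩 : Set C(V, W)) : Prop :=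
  closure 𝒩 = {f ∈ respecting (sepRel 𝒩) | ∀ (g : G) (v : V), f (ρ g v) = τ g (f v)}

end Separation

section Examples

variable (n : ℕ)

/-- The symmetric group `S_n`. -/
abbrev SymGroup : Type := Equiv.Perm (Fin n)

/-- `ℤ_n`, acting on `[n]` by modular shifts. -/
def cyclicShifts : Subgroup (SymGroup n) := Subgroup.zpowers (finRotate n)

/-- `C^k`: circular convolutional layers `v ↦ ∑_{i ≤ k} x_i A(e_i) v + y 𝟙` of filter width `k`,
where `A(x)` is the circulant matrix with first column `x`. -/
def convLayer (k : ℕ) : Submodule ℝ ((Fin n → ℝ) →ᵃ[ℝ] (Fin n → ℝ)) where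
  carrier := {f | ∃ (x : Fin n → ℝ) (y : ℝ), ∀ v : Fin n → ℝ,
    f v = (∑ i : Fin n with i.val < k,
      x i • (Matrix.circulant (Pi.single i (1 : ℝ))).mulVec v) + y • (1 : Fin n → ℝ)}
  zero_mem' := ⟨0, 0, fun v => by simp⟩
  add_mem' := by
    rintro f g ⟨x, y, hf⟩ ⟨x', y', hg⟩
    refine ⟨x + x', y + y', fun v => ?_⟩
    simp only [AffineMap.coe_add, hf v, hg v, Pi.add_apply, add_smul, Finset.sum_add_distrib]
    abel
  smul_mem' := by
    rintro c f ⟨x, y, hf⟩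
    refine ⟨c • x, c * y, fun v => ?_⟩
    simp only [AffineMap.coe_smul, hf v, Pi.smul_apply, smul_add, Finset.smul_sum, smul_smul,
      smul_eq_mul]

/-- `I = Aff_{ℤ_n}(ℝ^n, ℝ)`: invariant circular layers. -/
def invLayer : Submodule ℝ ((Fin n → ℝ) →ᵃ[ℝ] ℝ) :=
  equivAff (permRep (cyclicShifts n) (Fin n)) (Representation.trivial ℝ (cyclicShifts n) ℝ)

/-- `Aff_{S_n}(ℝ^X, ℝ^Y)` for `S_n`-sets `X` and `Y`. -/
def symAff (X Y : Type*) [MulAction (SymGroup n) X] [MulAction (SymGroup n) Y] :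
    Submodule ℝ ((X → ℝ) →ᵃ[ℝ] (Y → ℝ)) :=
  equivAff (permRep (SymGroup n) X) (permRep (SymGroup n) Y)

/-- `Aff_{S_n}(ℝ^X, ℝ)`, with `S_n` acting trivially on `ℝ`. -/
def symInv (X : Type*) [MulAction (SymGroup n) X] : Submodule ℝ ((X → ℝ) →ᵃ[ℝ] ℝ) :=
  equivAff (permRep (SymGroup n) X) (Representation.trivial ℝ (SymGroup n) ℝ)

/-- `U(C¹, I)`. -/
def cnnClass (σ : ℝ → ℝ) : Set C(Fin n → ℝ, ℝ) :=
  universalityClass σ (convLayer n 1) (invLayer n)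

/-- `U(ℝⁿ, ℝⁿ, ℝ)`. -/
def pointNetClass (σ : ℝ → ℝ) : Set C(Fin n → ℝ, ℝ) :=
  universalityClass σ (symAff n (Fin n) (Fin n)) (symInv n (Fin n))

/-- `U(ℝⁿ, ℝ^{S_n}, ℝ)`, where `S_n` acts on itself by left multiplication. -/
def regularClass (σ : ℝ → ℝ) : Set C(Fin n → ℝ, ℝ) :=
  universalityClass σ (symAff n (Fin n) (SymGroup n)) (symInv n (SymGroup n))

/-- `U(C¹, C^k)`: the equivariant counterpart of `U(C¹, I)`. -/
def cnnEquivClass (k : ℕ) (σ : ℝ → ℝ) : Set C(Fin n → ℝ, Fin n → ℝ) :=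
  universalityClass σ (convLayer n 1) (convLayer n k)

/-- `U(C¹, Aff_{S_n}(ℝⁿ, ℝ^Y))`. -/
def pointwiseEquivClass (Y : Type*) [MulAction (SymGroup n) Y] (σ : ℝ → ℝ) :
    Set C(Fin n → ℝ, Y → ℝ) :=
  universalityClass σ (convLayer n 1) (symAff n (Fin n) Y)

/-- `U(ℝⁿ, ℝⁿ, ℝ^Y)`. -/
def pointNetEquivClass (Y : Type*) [MulAction (SymGroup n) Y] (σ : ℝ → ℝ) :
    Set C(Fin n → ℝ, Y → ℝ) :=
  universalityClass σ (symAff n (Fin n) (Fin n)) (symAff n (Fin n) Y)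

/-- `U(ℝⁿ, ℝ^{S_n}, ℝ^Y)`. -/
def regularEquivClass (Y : Type*) [MulAction (SymGroup n) Y] (σ : ℝ → ℝ) :
    Set C(Fin n → ℝ, Y → ℝ) :=
  universalityClass σ (symAff n (Fin n) (SymGroup n)) (symAff n (SymGroup n) Y)

/-- The function `(x₁ + ⋯ + x_n)^n`. -/
def sumPow : C(Fin n → ℝ, ℝ) := ⟨fun x => (∑ i, x i) ^ n, by fun_prop⟩

/-- The function `x₁ ⋯ x_n`. -/
def coordProd : C(Fin n → ℝ, ℝ) := ⟨fun x => ∏ i, x i, by fun_prop⟩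

end Examples

end EquivariantNetworks

open EquivariantNetworks

/-!
A continuous activation that is not a polynomial spans a dense subspace of `C(ℝ, ℝ)` under
rescaling and translation (Leshno–Lin–Pinkus–Schocken), hence its ridge functions span a dense
subspace of `C(ℝⁿ, ℝ)`. The average of a neuron over a finite group is a single network whose hidden
representation is the regular one, so these networks are dense in all continuous equivariant maps.

The smaller classes are annihilated by linear functionals. A width-1 CNN processes each coordinate
on its own, so `F (u + v) + F 0 = F u + F v` whenever `u` and `v` have disjoint supports; this fails
for `(x₁ + ⋯ + x_n)^n`. Each hidden coordinate of a PointNet sees one input coordinate and the sum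
of all of them, so its networks vanish on every signed combination of points that have the same
coordinate sum and whose one-dimensional marginals cancel; this fails for `x₁ ⋯ x_n` if `n > 3` and
for `(x₁² + ⋯ + x_n²)³` if `n > 2`.

The separation relations nevertheless coincide, because width-1 CNNs already recover the multiset of
coordinates of the input if the output is invariant, and the input itself if the output is `ℝⁿ`.
-/

namespace EquivariantNetworks

section CompactOpen

open MeasureTheory

theorem mem_closure_of_forall_restrict {X E : Type*} [TopologicalSpace X] [UniformSpace E]
    {S : Set C(X, E)} {f : C(X, E)}
    (h : ∀ K, IsCompact K → f.restrict K ∈ closure (ContinuousMap.restrict K '' S)) :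
    f ∈ closure S := by
  refine (mem_closure_iff_nhds_basis (nhds_basis_uniformity'
    ContinuousMap.hasBasis_compactConvergenceUniformity)).2 fun ⟨K, U⟩ ⟨hK, hU⟩ => ?_
  have : CompactSpace K := isCompact_iff_compactSpace.1 hK
  obtain ⟨_, ⟨g, hg, rfl⟩, hgU⟩ := (mem_closure_iff_nhds_basis (nhds_basis_uniformity'
    ContinuousMap.hasBasis_compactConvergenceUniformity_of_compact)).1 (h K hK) U hU
  exact ⟨g, hg, fun x hx => hgU ⟨x, hx⟩⟩

theorem dense_of_separatesPoints {X : Type*} [TopologicalSpace X] {A : Subalgebra ℝ C(X, ℝ)}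
    (hA : A.SeparatesPoints) : Dense (A : Set C(X, ℝ)) := by
  refine fun f => mem_closure_of_forall_restrict fun K hK => ?_
  have : CompactSpace K := isCompact_iff_compactSpace.1 hK
  let r : C(X, ℝ) →ₐ[ℝ] C(K, ℝ) :=
    ContinuousMap.compRightAlgHom ℝ ℝ ⟨Subtype.val, continuous_subtype_val⟩
  refine ContinuousMap.continuousMap_mem_subalgebra_closure_of_separatesPoints (A.map r)
    (fun x y hxy => ?_) (f.restrict K)
  obtain ⟨_, ⟨g, hg, rfl⟩, hgxy⟩ := hA (Subtype.coe_ne_coe.2 hxy)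
  exact ⟨_, ⟨r g, ⟨g, hg, rfl⟩, rfl⟩, hgxy⟩

theorem eq_top_of_submonoid_separatesPoints {X : Type*} [TopologicalSpace X]
    {S : Submodule ℝ C(X, ℝ)} (hS : IsClosed (S : Set C(X, ℝ))) {M : Submonoid C(X, ℝ)}
    (hM : ∀ x y, x ≠ y → ∃ f ∈ M, f x ≠ f y) (hMS : ∀ f ∈ M, f ∈ S) : S = ⊤ := by
  let A : Subalgebra ℝ C(X, ℝ) := Algebra.adjoin ℝ (M : Set C(X, ℝ))
  have hA : A.SeparatesPoints := fun x y hxy => by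
    obtain ⟨f, hf, hfxy⟩ := hM x y hxy
    exact ⟨f, ⟨f, Algebra.subset_adjoin hf, rfl⟩, hfxy⟩
  have hAS : Subalgebra.toSubmodule A ≤ S := by
    rw [Algebra.adjoin_eq_span, Submonoid.closure_eq]
    exact Submodule.span_le.2 hMS
  exact SetLike.coe_injective (hS.closure_eq.symm.trans
    ((dense_of_separatesPoints hA).mono hAS).closure_eq)

theorem integral_mem_of_isClosed {α E : Type*} [MeasurableSpace α] {μ : Measure α}
    [NormedAddCommGroup E] [NormedSpace ℝ E] [CompleteSpace E] {T : Submodule ℝ E}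
    (hT : IsClosed (T : Set E)) {f : α → E} (hf : ∀ a, f a ∈ T) : ∫ a, f a ∂μ ∈ T := by
  have : CompleteSpace T := hT.completeSpace_coe
  rw [show ∫ a, f a ∂μ = T.subtypeₗᵢ (∫ a, ⟨f a, hf a⟩ ∂μ) from
    T.subtypeₗᵢ.integral_comp_comm fun a => (⟨f a, hf a⟩ : T)]
  exact Subtype.property _

theorem mem_of_isClosed_of_eq_integral {X Y : Type*} [TopologicalSpace X] [TopologicalSpace Y]
    [MeasurableSpace Y] [OpensMeasurableSpace Y] {μ : Measure Y} [IsFiniteMeasureOnCompacts μ]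
    {S : Submodule ℝ C(X, ℝ)} (hS : IsClosed (S : Set C(X, ℝ))) {c : C(Y, C(X, ℝ))}
    (hc : HasCompactSupport c) (hcS : ∀ y, c y ∈ S) {F : C(X, ℝ)}
    (hF : ∀ x, F x = ∫ y, c y x ∂μ) : F ∈ S := by
  rw [← SetLike.mem_coe, ← hS.closure_eq]
  refine mem_closure_of_forall_restrict fun K hK => ?_
  have : CompactSpace K := isCompact_iff_compactSpace.1 hK
  let r : C(X, ℝ) →L[ℝ] C(K, ℝ) :=
    ContinuousMap.compCLM ℝ ℝ ⟨Subtype.val, continuous_subtype_val⟩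
  have hrc : Integrable (fun y => r (c y)) μ :=
    (r.continuous.comp c.continuous).integrable_of_hasCompactSupport (hc.comp_left (map_zero r))
  have hF' : F.restrict K = ∫ y, r (c y) ∂μ := ContinuousMap.ext fun x =>
    (hF x).trans ((ContinuousMap.evalCLM ℝ x).integral_comp_comm hrc)
  rw [hF']
  exact integral_mem_of_isClosed (T := (S.map (r : C(X, ℝ) →ₗ[ℝ] C(K, ℝ))).topologicalClosure)
    (Submodule.isClosed_topologicalClosure _)
    fun y => Submodule.le_topologicalClosure _ ⟨c y, hcS y, rfl⟩

end CompactOpen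

section Activation

open Filter Topology MeasureTheory
open scoped Convolution

/-- The one-dimensional neuron `t ↦ s (a t + b)` with activation `s`, weight `a` and bias `b`. -/
def dilate (s : C(ℝ, ℝ)) (a b : ℝ) : C(ℝ, ℝ) := s.comp ⟨fun t => a * t + b, by fun_prop⟩

@[simp]
theorem dilate_apply (s : C(ℝ, ℝ)) (a b t : ℝ) : dilate s a b t = s (a * t + b) := rfl

/-- An activation is universal if the one-dimensional neurons built from it span a dense subspace
of `C(ℝ, ℝ)`. -/
def IsUniversalActivation (s : C(ℝ, ℝ)) : Prop :=
  Dense (Submodule.span ℝ (Set.range fun p : ℝ × ℝ => dilate s p.1 p.2) : Set C(ℝ, ℝ))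

theorem exists_continuous_taylor_quotient {k : ℕ} {g : ℝ → ℝ} (hg : ContDiff ℝ k g) (b : ℝ) :
    ∃ q : C(ℝ, ℝ), q 0 = iteratedDeriv k g b / k.factorial ∧ ∀ u, g (u + b) =
      ∑ j ∈ Finset.range k, iteratedDeriv j g b / j.factorial * u ^ j + u ^ k * q u := by
  set T : ℝ → ℝ := fun u => ∑ j ∈ Finset.range k, iteratedDeriv j g b / j.factorial * u ^ j
  set d := iteratedDeriv k g b / k.factorial
  set r : ℝ → ℝ := fun u => (g (u + b) - T u) / u ^ k
  have hT0 : g b = T 0 + 0 ^ k * d := by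
    rcases k with _ | k
    · simp [T, d]
    · simp [T, Finset.sum_range_succ']
  have hd : Tendsto r (𝓝[≠] 0) (𝓝 d) := by
    have hlim := (Real.taylor_tendsto convex_univ (Set.mem_univ b) hg.contDiffOn).comp
      (f := fun u => u + b) (x := 𝓝[≠] 0) <| by
        rw [nhdsWithin_univ]
        exact ((continuous_add_const b).tendsto' 0 b (zero_add b)).mono_left nhdsWithin_le_nhds
    refine tendsto_sub_nhds_zero_iff.1 (hlim.congr' ?_)
    filter_upwards [self_mem_nhdsWithin] with u hu
    have hu : u ^ k ≠ 0 := pow_ne_zero k hu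
    simp only [Function.comp_apply, taylor_within_apply, iteratedDerivWithin_univ,
      add_sub_cancel_right, Finset.sum_range_succ, smul_eq_mul, r, T, d]
    field_simp
    simp only [div_eq_mul_inv]
    ring_nf
  have hr : ∀ u ≠ 0, ContinuousAt r u := fun u hu =>
    ContinuousAt.div (by have := hg.continuous; fun_prop) (by fun_prop) (pow_ne_zero k hu)
  refine ⟨⟨Function.update r 0 d, continuous_iff_continuousAt.2 fun u => ?_⟩, by simp, fun u => ?_⟩
  · rcases eq_or_ne u 0 with rfl | hu
    · exact continuousAt_update_same.2 hd
    · exact (continuousAt_update_of_ne hu).2 (hr u hu)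
  · rcases eq_or_ne u 0 with rfl | hu
    · simpa using hT0
    · have hru : u ^ k * r u = g (u + b) - T u := mul_div_cancel₀ _ (pow_ne_zero k hu)
      simp [Function.update_of_ne hu, hru, T]

/-- The remainder of the Taylor expansion of `t ↦ g (a t + b)`, divided by `a ^ k`, tends to a
multiple of `t ^ k` as `a → 0`. -/
theorem id_pow_mem_of_iteratedDeriv_ne_zero {S : Submodule ℝ C(ℝ, ℝ)}
    (hS : IsClosed (S : Set C(ℝ, ℝ))) {k : ℕ} {g : C(ℝ, ℝ)} (hg : ContDiff ℝ k g) {b : ℝ}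
    (hb : iteratedDeriv k g b ≠ 0) (hgS : ∀ a, dilate g a b ∈ S)
    (hlt : ∀ j < k, ContinuousMap.id ℝ ^ j ∈ S) : ContinuousMap.id ℝ ^ k ∈ S := by
  obtain ⟨q, hq0, hq⟩ := exists_continuous_taylor_quotient hg b
  let c : C(ℝ, C(ℝ, ℝ)) := ContinuousMap.curry ⟨fun p => p.2 ^ k * q (p.1 * p.2), by fun_prop⟩
  have hc : ∀ a ≠ 0, c a ∈ S := fun a ha => by
    have hca : c a = (a ^ k)⁻¹ • (dilate g a b - ∑ j ∈ Finset.range k,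
        (iteratedDeriv j g b / j.factorial * a ^ j) • ContinuousMap.id ℝ ^ j) := by
      ext t
      simp [c, hq, mul_pow, mul_assoc, ha]
    rw [hca]
    exact S.smul_mem _ (S.sub_mem (hgS a) (S.sum_mem fun j hj =>
      S.smul_mem _ (hlt j (Finset.mem_range.1 hj))))
  have hc0 : c 0 ∈ S := closure_minimal hc (hS.preimage c.continuous) (dense_compl_singleton 0 0)
  have h0 : c 0 = (iteratedDeriv k g b / k.factorial) • ContinuousMap.id ℝ ^ k := by
    ext t
    simp [c, hq0, mul_comm]
  rw [h0] at hc0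
  exact (S.smul_mem_iff (div_ne_zero hb (by positivity))).1 hc0

theorem dilate_mem_of_eq_convolution {S : Submodule ℝ C(ℝ, ℝ)} (hS : IsClosed (S : Set C(ℝ, ℝ)))
    {s φ g : C(ℝ, ℝ)} (hφ : HasCompactSupport φ) (hg : ∀ t, g t = ∫ y, φ y * s (t - y)) {a : ℝ}
    (hs : ∀ b, dilate s a b ∈ S) (b : ℝ) : dilate g a b ∈ S := by
  let c : C(ℝ, C(ℝ, ℝ)) :=
    ContinuousMap.curry ⟨fun p => φ p.1 * s (a * p.2 + b - p.1), by fun_prop⟩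
  have hc : ∀ y, c y = φ y • dilate s a (b - y) := fun y => by
    ext t
    simp [c, add_sub_assoc]
  have hc_supp : HasCompactSupport c := hφ.mono fun y hy h0 => hy (by simp [hc, h0])
  exact mem_of_isClosed_of_eq_integral hS hc_supp (fun y => hc y ▸ S.smul_mem _ (hs _))
    fun t => hg (a * t + b)

theorem exists_polynomial_of_iteratedDeriv_eq_zero {k : ℕ} {f : ℝ → ℝ} (hf : ContDiff ℝ k f)
    (h : ∀ t, iteratedDeriv k f t = 0) :
    ∃ p : Polynomial ℝ, p.degree < k ∧ ∀ t, f t = p.eval t := by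
  rcases k with _ | k
  · exact ⟨0, by simp, fun t => by simpa using h t⟩
  refine ⟨∑ j ∈ Finset.range (k + 1), Polynomial.monomial j (iteratedDeriv j f 0 / j.factorial),
    ?_, fun t => ?_⟩
  · rw [← Polynomial.mem_degreeLT]
    exact Submodule.sum_mem _ fun j hj => Polynomial.mem_degreeLT.2 <|
      (Polynomial.degree_monomial_le _ _).trans_lt (by exact_mod_cast Finset.mem_range.1 hj)
  · simp only [Polynomial.eval_finsetSum, Polynomial.eval_monomial]
    rcases eq_or_ne t 0 with rfl | ht
    · simp [Finset.sum_range_succ']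
    obtain ⟨u, -, hu⟩ := taylor_mean_remainder_lagrange_iteratedDeriv ht.symm
      (hf.contDiffOn (s := Set.uIcc 0 t))
    rw [h u, zero_mul, zero_div, sub_eq_zero, taylor_within_apply] at hu
    rw [hu]
    refine Finset.sum_congr rfl fun j hj => ?_
    rw [iteratedDerivWithin_eq_iteratedDeriv (uniqueDiffOn_uIcc ht.symm)
      (hf.contDiffAt.of_le (by exact_mod_cast (Finset.mem_range.1 hj).le)) Set.left_mem_uIcc,
      sub_zero, smul_eq_mul]
    ring

theorem exists_polynomial_of_tendsto {ι : Type*} {l : Filter ι} [l.NeBot] {k : ℕ}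
    {p : ι → Polynomial ℝ} (hp : ∀ i, (p i).degree < k) {f : ℝ → ℝ}
    (h : ∀ t, Tendsto (fun i => (p i).eval t) l (𝓝 (f t))) :
    ∃ q : Polynomial ℝ, ∀ t, f t = q.eval t := by
  let P : Submodule ℝ (ℝ → ℝ) :=
    (Polynomial.degreeLT ℝ k).map (LinearMap.pi fun t => Polynomial.leval t)
  have hP : IsClosed (P : Set (ℝ → ℝ)) := Submodule.closed_of_finiteDimensional P
  obtain ⟨q, -, hq⟩ : f ∈ P := hP.mem_of_tendsto (tendsto_pi_nhds.2 h)
    (Eventually.of_forall fun i => ⟨p i, Polynomial.mem_degreeLT.2 (hp i), rfl⟩)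
  exact ⟨q, fun t => (congrFun hq t).symm⟩

theorem exists_polynomial_of_id_pow_notMem {S : Submodule ℝ C(ℝ, ℝ)}
    (hS : IsClosed (S : Set C(ℝ, ℝ))) {s : C(ℝ, ℝ)} (hs : ∀ a b, dilate s a b ∈ S) {k : ℕ}
    (hk : ContinuousMap.id ℝ ^ k ∉ S) (hlt : ∀ j < k, ContinuousMap.id ℝ ^ j ∈ S) :
    ∃ p : Polynomial ℝ, ∀ t, s t = p.eval t := by
  let φ : ℕ → ContDiffBump (0 : ℝ) := fun i =>
    ⟨1 / ((i : ℝ) + 1) / 2, 1 / ((i : ℝ) + 1), by positivity, half_lt_self (by positivity)⟩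
  have hφ : Tendsto (fun i => (φ i).rOut) atTop (𝓝 0) := tendsto_one_div_add_atTop_nhds_zero_nat
  let g : ℕ → ℝ → ℝ := fun i => (φ i).normed volume ⋆ s
  have hg : ∀ i, ContDiff ℝ k (g i) := fun i =>
    (φ i).hasCompactSupport_normed.contDiff_convolution_left (n := k) _ (φ i).contDiff_normed
      s.continuous.locallyIntegrable
  have hg_deriv : ∀ i t, iteratedDeriv k (g i) t = 0 := fun i t => by
    by_contra h0
    refine hk (id_pow_mem_of_iteratedDeriv_ne_zero (g := ⟨g i, (hg i).continuous⟩) hS (hg i) h0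
      (fun a => ?_) hlt)
    exact dilate_mem_of_eq_convolution hS
      (φ := ⟨(φ i).normed volume, ((φ i).contDiff_normed (n := 0)).continuous⟩)
      (φ i).hasCompactSupport_normed (fun _ => rfl) (hs a) t
  choose p hp hpg using fun i => exists_polynomial_of_iteratedDeriv_eq_zero (hg i) (hg_deriv i)
  refine exists_polynomial_of_tendsto (l := atTop) hp fun t => ?_
  simpa only [← hpg] using ContDiffBump.convolution_tendsto_right_of_continuous hφ s.continuous t

theorem eq_top_of_id_pow_mem {S : Submodule ℝ C(ℝ, ℝ)} (hS : IsClosed (S : Set C(ℝ, ℝ)))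
    (h : ∀ k, ContinuousMap.id ℝ ^ k ∈ S) : S = ⊤ := by
  refine eq_top_of_submonoid_separatesPoints hS (M := Submonoid.powers (ContinuousMap.id ℝ))
    (fun x y hxy => ⟨_, Submonoid.mem_powers _, hxy⟩) ?_
  rintro _ ⟨k, rfl⟩
  exact h k

/-- Leshno–Lin–Pinkus–Schocken: if `t ^ k` is the first monomial missing from the closed span of
the neurons, all mollifications of `s` have vanishing `k`-th derivative, so `s` is a pointwise
limit of polynomials of degree less than `k`. -/
theorem isUniversalActivation_of_not_polynomial {s : C(ℝ, ℝ)}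
    (hs : ¬ ∃ p : Polynomial ℝ, ∀ t, s t = p.eval t) : IsUniversalActivation s := by
  set S := (Submodule.span ℝ (Set.range fun p : ℝ × ℝ => dilate s p.1 p.2)).topologicalClosure
  have hS : IsClosed (S : Set C(ℝ, ℝ)) := Submodule.isClosed_topologicalClosure _
  have hsS : ∀ a b, dilate s a b ∈ S := fun a b =>
    Submodule.le_topologicalClosure _ (Submodule.subset_span ⟨(a, b), rfl⟩)
  have hpow : ∀ k, ContinuousMap.id ℝ ^ k ∈ S := fun k => by
    induction k using Nat.strong_induction_on with
    | _ k ih => exact not_not.1 fun hk => hs (exists_polynomial_of_id_pow_notMem hS hsS hk ih)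
  exact Submodule.dense_iff_topologicalClosure_eq_top.2 (eq_top_of_id_pow_mem hS hpow)

theorem IsUniversalActivation.eq_top {s : C(ℝ, ℝ)} (hs : IsUniversalActivation s)
    {S : Submodule ℝ C(ℝ, ℝ)} (hS : IsClosed (S : Set C(ℝ, ℝ))) (h : ∀ a b, dilate s a b ∈ S) :
    S = ⊤ := by
  refine top_le_iff.1 ((Submodule.dense_iff_topologicalClosure_eq_top.1 hs).ge.trans ?_)
  refine Submodule.topologicalClosure_minimal _ (Submodule.span_le.2 ?_) hS
  rintro _ ⟨⟨a, b⟩, rfl⟩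
  exact h a b

/-- The exponentials `exp ∘ w` span a subalgebra, because they are closed under multiplication. -/
theorem IsUniversalActivation.eq_top_of_ridge_mem {s : C(ℝ, ℝ)} (hs : IsUniversalActivation s)
    {E : Type*} [AddCommGroup E] [TopologicalSpace E] [Module ℝ E] [SeparatingDual ℝ E]
    {S : Submodule ℝ C(E, ℝ)} (hS : IsClosed (S : Set C(E, ℝ)))
    (h : ∀ (w : E →L[ℝ] ℝ) (b : ℝ), (dilate s 1 b).comp (w : C(E, ℝ)) ∈ S) : S = ⊤ := by
  have hridge : ∀ (w : E →L[ℝ] ℝ) (f : C(ℝ, ℝ)), f.comp (w : C(E, ℝ)) ∈ S := fun w => by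
    let r : C(ℝ, ℝ) →L[ℝ] C(E, ℝ) := ContinuousMap.compCLM ℝ ℝ (w : C(E, ℝ))
    refine Submodule.eq_top_iff'.1
      (hs.eq_top (S := S.comap (r : C(ℝ, ℝ) →ₗ[ℝ] C(E, ℝ))) (hS.preimage r.continuous)
        fun a b => ?_)
    have hr : r (dilate s a b) = (dilate s 1 b).comp ((a • w : E →L[ℝ] ℝ) : C(E, ℝ)) := by
      ext x
      simp [r]
    rw [Submodule.mem_comap, ContinuousLinearMap.coe_coe, hr]
    exact h (a • w) b
  let e : (E →L[ℝ] ℝ) → C(E, ℝ) := fun w =>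
    (⟨Real.exp, Real.continuous_exp⟩ : C(ℝ, ℝ)).comp (w : C(E, ℝ))
  let M : Submonoid C(E, ℝ) :=
    { carrier := Set.range e
      one_mem' := ⟨0, by ext; simp [e]⟩
      mul_mem' := by
        rintro _ _ ⟨v, rfl⟩ ⟨w, rfl⟩
        exact ⟨v + w, by ext; simp [e, Real.exp_add]⟩ }
  refine eq_top_of_submonoid_separatesPoints hS (M := M) (fun x y hxy => ?_) ?_
  · obtain ⟨w, hw⟩ := SeparatingDual.exists_separating_of_ne (R := ℝ) hxy
    exact ⟨e w, ⟨w, rfl⟩, by simpa [e] using hw⟩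
  · rintro _ ⟨w, rfl⟩
    exact hridge w _

end Activation

section Networks

theorem affineMap_sum_apply {P Q ι : Type*} [AddCommGroup P] [Module ℝ P]
    [AddCommGroup Q] [Module ℝ Q] (s : Finset ι)
    (f : ι → (P →ᵃ[ℝ] Q)) (x : P) : (∑ i ∈ s, f i) x = ∑ i ∈ s, f i x :=
  map_sum (AddMonoidHom.mk' (fun f : P →ᵃ[ℝ] Q => f x) fun _ _ => rfl) f s

variable {V Y Z : Type*} [AddCommGroup V] [Module ℝ V] [TopologicalSpace V]
  [AddCommGroup Z] [Module ℝ Z] [TopologicalSpace Z] {σ : ℝ → ℝ}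
  {M M' : Submodule ℝ (V →ᵃ[ℝ] (Y → ℝ))} {N N' : Submodule ℝ ((Y → ℝ) →ᵃ[ℝ] Z)}

theorem mem_networks_iff {F : C(V, Z)} :
    F ∈ networks σ M N ↔ ∃ (h : ℕ) (f : Fin h → (V →ᵃ[ℝ] (Y → ℝ)))
      (g : Fin h → ((Y → ℝ) →ᵃ[ℝ] Z)), (∀ j, f j ∈ M) ∧ (∀ j, g j ∈ N) ∧
      ∀ v, F v = ∑ j, g j (pointwise σ (f j v)) := by
  constructor
  · rintro ⟨h, φ, ⟨g, hg, hφ⟩, η, ⟨f, hf, hη⟩, hF⟩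
    refine ⟨h, f, g, hf, hg, fun v => ?_⟩
    rw [hF, Function.comp_apply, Function.comp_apply, hφ]
    simp only [pointwise, hη]
    rfl
  · rintro ⟨h, f, g, hf, hg, hF⟩
    refine ⟨h, ∑ j, (g j).comp (LinearMap.funLeft ℝ ℝ (fun y => (y, j))).toAffineMap,
      ⟨g, hg, fun w => ?_⟩,
      AffineMap.pi fun p : Y × Fin h =>
        (LinearMap.proj (R := ℝ) (φ := fun _ : Y => ℝ) p.1).toAffineMap.comp (f p.2),
      ⟨f, hf, fun v y j => rfl⟩, ?_⟩
    · rw [affineMap_sum_apply]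
      rfl
    · ext v
      rw [hF, Function.comp_apply, Function.comp_apply, affineMap_sum_apply]
      rfl

theorem mem_networks_of_eq {F : C(V, Z)} {f : V →ᵃ[ℝ] (Y → ℝ)} {g : (Y → ℝ) →ᵃ[ℝ] Z}
    (hf : f ∈ M) (hg : g ∈ N) (h : ∀ v, F v = g (pointwise σ (f v))) : F ∈ networks σ M N :=
  mem_networks_iff.2 ⟨1, fun _ => f, fun _ => g, fun _ => hf, fun _ => hg, fun v => by simp [h]⟩

theorem networks_mono (hM : M ≤ M') (hN : N ≤ N') : networks σ M N ⊆ networks σ M' N' := by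
  intro F hF
  obtain ⟨h, f, g, hf, hg, hF⟩ := mem_networks_iff.1 hF
  exact mem_networks_iff.2 ⟨h, f, g, fun j => hM (hf j), fun j => hN (hg j), hF⟩

theorem universalityClass_mono (hM : M ≤ M') (hN : N ≤ N') :
    universalityClass σ M N ⊆ universalityClass σ M' N' :=
  closure_mono (networks_mono hM hN)

/-- The networks of all widths form a linear subspace of `C(V, Z)`. -/
def networksSubmodule [IsTopologicalAddGroup Z] [ContinuousConstSMul ℝ Z] (σ : ℝ → ℝ)
    (M : Submodule ℝ (V →ᵃ[ℝ] (Y → ℝ))) (N : Submodule ℝ ((Y → ℝ) →ᵃ[ℝ] Z)) :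
    Submodule ℝ C(V, Z) where
  carrier := networks σ M N
  zero_mem' := mem_networks_iff.2 ⟨0, nofun, nofun, nofun, nofun, fun v => by simp⟩
  add_mem' := by
    intro F F' hF hF'
    obtain ⟨h, f, g, hf, hg, hF⟩ := mem_networks_iff.1 hF
    obtain ⟨h', f', g', hf', hg', hF'⟩ := mem_networks_iff.1 hF'
    refine mem_networks_iff.2 ⟨h + h', Fin.append f f', Fin.append g g', fun j => ?_,
      fun j => ?_, fun v => ?_⟩
    · refine Fin.addCases (fun i => ?_) (fun i => ?_) j
      · simpa using hf i
      · simpa using hf' i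
    · refine Fin.addCases (fun i => ?_) (fun i => ?_) j
      · simpa using hg i
      · simpa using hg' i
    · simp [Fin.sum_univ_add, hF, hF']
  smul_mem' := by
    intro c F hF
    obtain ⟨h, f, g, hf, hg, hF⟩ := mem_networks_iff.1 hF
    exact mem_networks_iff.2 ⟨h, f, fun j => c • g j, hf, fun j => N.smul_mem c (hg j),
      fun v => by simp [hF, Finset.smul_sum]⟩

theorem sum_smul_eq_zero_of_mem_universalityClass [IsTopologicalAddGroup Z]
    [ContinuousConstSMul ℝ Z] [T2Space Z] {ι : Type*} [Fintype ι] (w : ι → ℝ) (p : ι → V)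
    (hw : ∑ k, w k = 0) (hM : ∀ f ∈ M, ∑ k, w k • pointwise σ (f (p k)) = 0)
    {F : C(V, Z)} (hF : F ∈ universalityClass σ M N) : ∑ k, w k • F (p k) = 0 := by
  have hc : IsClosed {F : C(V, Z) | ∑ k, w k • F (p k) = 0} := by
    refine isClosed_eq ?_ continuous_const
    exact continuous_finsetSum _ fun k _ => (continuous_eval_const _).const_smul _
  refine closure_minimal ?_ hc hF
  intro F hF
  obtain ⟨h, f, g, hf, -, hF⟩ := mem_networks_iff.1 hF
  simp only [Set.mem_ofPred_eq, hF, Finset.smul_sum]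
  rw [Finset.sum_comm]
  refine Finset.sum_eq_zero fun j _ => ?_
  have hdecomp : ∀ u, g j u = (g j).linear u + g j 0 := congrFun (g j).decomp
  simp only [hdecomp (pointwise _ _), smul_add, Finset.sum_add_distrib, ← Finset.sum_smul, hw,
    zero_smul, add_zero, ← map_smul, ← map_sum]
  rw [hM _ (hf j), map_zero]

variable {G : Type*} [Group G] [MulAction G Y] {ρ : Representation ℝ G V}
  {τ : Representation ℝ G Z}

theorem map_rep_of_mem_universalityClass [T2Space Z] (hτ : ∀ g, Continuous (τ g))
    (hM : M ≤ equivAff ρ (permRep G Y)) (hN : N ≤ equivAff (permRep G Y) τ) {F : C(V, Z)}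
    (hF : F ∈ universalityClass σ M N) (g : G) (v : V) : F (ρ g v) = τ g (F v) := by
  have hc : IsClosed {F : C(V, Z) | F (ρ g v) = τ g (F v)} :=
    isClosed_eq (continuous_eval_const _)
      ((hτ g).comp (continuous_eval_const _))
  refine closure_minimal ?_ hc hF
  intro F hF
  obtain ⟨h, f, g', hf, hg, hF⟩ := mem_networks_iff.1 hF
  simp only [Set.mem_ofPred_eq, hF, map_sum]
  refine Finset.sum_congr rfl fun j _ => ?_
  rw [← hN (hg j), hM (hf j)]
  rfl

end Networks

section RegularRepresentation

variable {V Z : Type*} [TopologicalSpace V]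
  [AddCommGroup Z] [Module ℝ Z] [TopologicalSpace Z] [IsTopologicalAddGroup Z] [ContinuousSMul ℝ Z]

/-- The vector-valued map `v ↦ f v • z`, as a function of the scalar function `f`. -/
def smulConst (z : Z) : C(V, ℝ) →L[ℝ] C(V, Z) :=
  (ContinuousLinearMap.toSpanSingleton ℝ z).compLeftContinuous ℝ V

@[simp]
theorem smulConst_apply (z : Z) (f : C(V, ℝ)) (v : V) : smulConst z f v = f v • z := rfl

@[simp]
theorem smulConst_one (f : C(V, ℝ)) : smulConst (1 : ℝ) f = f := by
  ext v
  simp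

theorem eq_top_of_smulConst_mem [T2Space Z] [FiniteDimensional ℝ Z] {S : Submodule ℝ C(V, Z)}
    (h : ∀ (z : Z) (f : C(V, ℝ)), smulConst z f ∈ S) : S = ⊤ := by
  refine Submodule.eq_top_iff'.2 fun F => ?_
  let b := Module.finBasis ℝ Z
  have hF : F = ∑ i, smulConst (b i)
      ((b.coord i).toContinuousLinearMap.compLeftContinuous ℝ V F) := by
    ext v
    simp
  rw [hF]
  exact S.sum_mem fun i _ => h _ _

variable [AddCommGroup V] [Module ℝ V] [T2Space Z] [FiniteDimensional ℝ Z]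
  {G : Type*} [Group G] {ρ : Representation ℝ G V}

/-- Averaging over a finite group: the projection `F ↦ |G|⁻¹ ∑ g, τ g ∘ F ∘ ρ g⁻¹` of `C(V, Z)`
onto the equivariant maps. -/
noncomputable def symmetrize [Fintype G] (hρ : ∀ g, Continuous (ρ g)) (τ : Representation ℝ G Z) :
    C(V, Z) →L[ℝ] C(V, Z) :=
  (Fintype.card G : ℝ)⁻¹ • ∑ g : G, ((τ g).toContinuousLinearMap.compLeftContinuous ℝ V).comp
    (ContinuousMap.compCLM ℝ Z ⟨ρ g⁻¹, hρ g⁻¹⟩)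

theorem symmetrize_apply [Fintype G] (hρ : ∀ g, Continuous (ρ g)) (τ : Representation ℝ G Z)
    (F : C(V, Z)) (v : V) :
    symmetrize hρ τ F v = (Fintype.card G : ℝ)⁻¹ • ∑ g : G, τ g (F (ρ g⁻¹ v)) := by
  simp [symmetrize]

theorem symmetrize_eq_self [Fintype G] (hρ : ∀ g, Continuous (ρ g)) {τ : Representation ℝ G Z}
    {F : C(V, Z)} (hF : ∀ g v, F (ρ g v) = τ g (F v)) : symmetrize hρ τ F = F := by
  ext v
  have hterm : ∀ g : G, τ g (F (ρ g⁻¹ v)) = F v := fun g => by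
    rw [hF, ← Module.End.mul_apply, ← map_mul, mul_inv_cancel, map_one, Module.End.one_apply]
  simp [symmetrize_apply, hterm, ← Nat.cast_smul_eq_nsmul ℝ, smul_smul]

/-- The orbit of an affine form under `G` is an equivariant first layer with values in the regular
representation, so the average of a neuron over `G` is a single network. -/
theorem symmetrize_smulConst_ridge_mem_networks [Fintype G] (hρ : ∀ g, Continuous (ρ g))
    (τ : Representation ℝ G Z) (s : C(ℝ, ℝ)) (w : V →L[ℝ] ℝ) (b : ℝ) (z : Z) :
    symmetrize hρ τ (smulConst z ((dilate s 1 b).comp (w : C(V, ℝ)))) ∈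
      networks s (equivAff ρ (permRep G G)) (equivAff (permRep G G) τ) := by
  let first : V →ᵃ[ℝ] (G → ℝ) := AffineMap.pi fun g =>
    (w.toLinearMap ∘ₗ ρ g⁻¹).toAffineMap + AffineMap.const ℝ V b
  let readout : (G → ℝ) →ₗ[ℝ] Z :=
    Fintype.linearCombination ℝ fun g => (Fintype.card G : ℝ)⁻¹ • τ g z
  have hfirst : first ∈ equivAff ρ (permRep G G) := fun g v => by
    ext h
    simp [first, permRep, LinearMap.funLeft_apply]
  have hreadout : readout.toAffineMap ∈ equivAff (permRep G G) τ := fun g u => by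
    simp only [LinearMap.coe_toAffineMap, readout, Fintype.linearCombination_apply, map_sum,
      map_smul]
    rw [← Equiv.sum_comp (Equiv.mulLeft g)]
    simp [permRep, LinearMap.funLeft_apply]
  refine mem_networks_of_eq hfirst hreadout fun v => ?_
  simp [symmetrize_apply, readout, first, pointwise, Fintype.linearCombination_apply,
    Finset.smul_sum, smul_comm (s _)]

theorem mem_universalityClass_of_map_rep [SeparatingDual ℝ V] [Finite G] {s : C(ℝ, ℝ)}
    (hs : IsUniversalActivation s) (hρ : ∀ g, Continuous (ρ g)) {τ : Representation ℝ G Z}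
    {F : C(V, Z)} (hF : ∀ g v, F (ρ g v) = τ g (F v)) :
    F ∈ universalityClass s (equivAff ρ (permRep G G)) (equivAff (permRep G G) τ) := by
  cases nonempty_fintype G
  let N := (networksSubmodule s (equivAff ρ (permRep G G))
    (equivAff (permRep G G) τ)).topologicalClosure
  have hN : IsClosed (N : Set C(V, Z)) := Submodule.isClosed_topologicalClosure _
  have hsmul : ∀ (z : Z) (f : C(V, ℝ)), symmetrize hρ τ (smulConst z f) ∈ N := fun z => by
    let L : C(V, ℝ) →L[ℝ] C(V, Z) := (symmetrize hρ τ).comp (smulConst z)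
    exact Submodule.eq_top_iff'.1 (hs.eq_top_of_ridge_mem
      (S := N.comap (L : C(V, ℝ) →ₗ[ℝ] C(V, Z))) (hN.preimage L.continuous) fun w b =>
        Submodule.le_topologicalClosure _ (symmetrize_smulConst_ridge_mem_networks hρ τ s w b z))
  rw [← symmetrize_eq_self hρ hF]
  exact Submodule.eq_top_iff'.1 (eq_top_of_smulConst_mem
    (S := N.comap (symmetrize hρ τ : C(V, Z) →ₗ[ℝ] C(V, Z))) hsmul) F

end RegularRepresentation

section Layers

theorem mem_equivAff_iff {G V Z : Type*} [Group G] [AddCommGroup V] [Module ℝ V]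
    [AddCommGroup Z] [Module ℝ Z] {ρ : Representation ℝ G V} {τ : Representation ℝ G Z}
    {f : V →ᵃ[ℝ] Z} : f ∈ equivAff ρ τ ↔
      (∀ g v, f.linear (ρ g v) = τ g (f.linear v)) ∧ ∀ g, τ g (f 0) = f 0 := by
  have hdecomp : ∀ v, f v = f.linear v + f 0 := congrFun f.decomp
  constructor
  · intro hf
    have hconst : ∀ g, τ g (f 0) = f 0 := fun g => by rw [← hf, map_zero]
    refine ⟨fun g v => ?_, hconst⟩
    have hv := hf g v
    rwa [hdecomp, hdecomp v, map_add, hconst, add_left_inj] at hv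
  · rintro ⟨hlin, hconst⟩ g v
    rw [hdecomp, hdecomp v, hlin, map_add, hconst]

section Permutations

variable {G X : Type*} [Group G] [MulAction G X]

theorem permRep_apply (g : G) (v : X → ℝ) (x : X) : permRep G X g v x = v (g⁻¹ • x) := rfl

theorem permRep_single [DecidableEq X] (g : G) (x : X) (c : ℝ) :
    permRep G X g (Pi.single x c) = Pi.single (g • x) c := by
  ext y
  simp only [permRep_apply, Pi.single_apply, inv_smul_eq_iff]

theorem sum_permRep [Fintype X] (g : G) (v : X → ℝ) : ∑ x, permRep G X g v x = ∑ x, v x :=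
  Equiv.sum_comp (MulAction.toPerm g⁻¹) v

theorem apply_eq_of_forall_permRep_eq [MulAction.IsPretransitive G X] {v : X → ℝ}
    (hv : ∀ g, permRep G X g v = v) (x y : X) : v x = v y := by
  obtain ⟨g, rfl⟩ := MulAction.exists_smul_eq G y x
  rw [← hv g, permRep_apply, inv_smul_smul, hv]

theorem mem_equivAff_trivial_iff [Fintype X] [MulAction.IsPretransitive G X] {Z : Type*}
    [AddCommGroup Z] [Module ℝ Z] {f : (X → ℝ) →ᵃ[ℝ] Z} :
    f ∈ equivAff (permRep G X) (Representation.trivial ℝ G Z) ↔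
      ∃ z c : Z, ∀ v, f v = (∑ x, v x) • z + c := by
  classical
  constructor
  · intro hf
    obtain ⟨z, hz⟩ : ∃ z, ∀ x, f.linear (Pi.single x 1) = z := by
      rcases isEmpty_or_nonempty X with hX | ⟨⟨x₀⟩⟩
      · exact ⟨0, isEmptyElim⟩
      · refine ⟨f.linear (Pi.single x₀ 1), fun x => ?_⟩
        obtain ⟨g, rfl⟩ := MulAction.exists_smul_eq G x₀ x
        rw [← permRep_single]
        exact (mem_equivAff_iff.1 hf).1 g _
    refine ⟨z, f 0, fun v => ?_⟩
    have hsingle : ∀ x, f.linear (Pi.single x (v x)) = v x • z := fun x => by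
      rw [← hz x, ← map_smul, ← Pi.single_smul, smul_eq_mul, mul_one]
    rw [Finset.sum_smul, ← Finset.sum_congr rfl fun x _ => hsingle x, ← map_sum,
      Finset.univ_sum_single]
    exact congrFun f.decomp v
  · rintro ⟨z, c, hf⟩ g v
    rw [hf, hf, sum_permRep, Representation.isTrivial_def]
    rfl

/-- This is double transitivity of the symmetric group. -/
theorem exists_eq_smul_one_add_of_submatrix_perm_eq {R : Type*} [Ring R] [DecidableEq X]
    {A : Matrix X X R} (hA : ∀ g : Equiv.Perm X, A.submatrix g g = A) :
    ∃ a b : R, A = a • 1 + Matrix.of fun _ _ => b := by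
  have hentry : ∀ (g : Equiv.Perm X) x y, A (g x) (g y) = A x y := fun g x y =>
    congrFun₂ (hA g) x y
  have hdiag : ∀ x y, A x x = A y y := fun x y => by
    rw [← hentry (Equiv.swap x y) x x, Equiv.swap_apply_left]
  obtain ⟨b, hb⟩ : ∃ b, ∀ x y, x ≠ y → A x y = b := by
    by_cases h : ∃ x₀ y₀ : X, x₀ ≠ y₀
    · obtain ⟨x₀, y₀, h₀⟩ := h
      refine ⟨A x₀ y₀, fun x y hxy => ?_⟩
      obtain ⟨g, rfl, rfl⟩ := MulAction.is_two_pretransitive_iff.1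
        (Equiv.Perm.isMultiplyPretransitive X 2) h₀ hxy
      exact hentry g x₀ y₀
    · push Not at h
      exact ⟨0, fun x y hxy => absurd (h x y) hxy⟩
  rcases isEmpty_or_nonempty X with hX | ⟨⟨x₀⟩⟩
  · exact ⟨0, 0, Subsingleton.elim _ _⟩
  · refine ⟨A x₀ x₀ - b, b, Matrix.ext fun x y => ?_⟩
    rcases eq_or_ne x y with rfl | hxy
    · simp [hdiag x x₀]
    · simp [hb x y hxy, hxy]

theorem mem_equivAff_perm_iff [Fintype X] {f : (X → ℝ) →ᵃ[ℝ] (X → ℝ)} :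
    f ∈ equivAff (permRep (Equiv.Perm X) X) (permRep (Equiv.Perm X) X) ↔
      ∃ a b c : ℝ, ∀ v x, f v x = a * v x + b * ∑ y, v y + c := by
  classical
  constructor
  · intro hf
    obtain ⟨hlin, hconst⟩ := mem_equivAff_iff.1 hf
    obtain ⟨a, b, hA⟩ := exists_eq_smul_one_add_of_submatrix_perm_eq
      (A := LinearMap.toMatrix' f.linear) fun g => Matrix.ext fun x y => by
        simp only [Matrix.submatrix_apply, LinearMap.toMatrix'_apply]
        rw [← Equiv.Perm.smul_def g y, ← permRep_single, hlin, permRep_apply,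
          ← Equiv.Perm.smul_def g x, inv_smul_smul]
    obtain ⟨c, hc⟩ : ∃ c, ∀ x, f 0 x = c := by
      rcases isEmpty_or_nonempty X with hX | ⟨⟨x₀⟩⟩
      · exact ⟨0, isEmptyElim⟩
      · exact ⟨f 0 x₀, fun x => apply_eq_of_forall_permRep_eq hconst x x₀⟩
    refine ⟨a, b, c, fun v x => ?_⟩
    have hlinear : f.linear v x = a * v x + b * ∑ y, v y := by
      rw [← LinearMap.toMatrix'_mulVec, hA, Matrix.add_mulVec, Matrix.smul_mulVec,
        Matrix.one_mulVec]
      simp [Matrix.mulVec, dotProduct, Finset.mul_sum]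
    rw [← hlinear, ← hc x]
    exact congrFun₂ f.decomp v x
  · rintro ⟨a, b, c, hf⟩ g v
    ext x
    rw [hf, sum_permRep, permRep_apply, permRep_apply, hf]

/-- The affine map `v ↦ a v + b 𝟙`, which is the general element of `C¹`. -/
def scaleShift (X : Type*) (a b : ℝ) : (X → ℝ) →ᵃ[ℝ] (X → ℝ) :=
  a • AffineMap.id ℝ (X → ℝ) + AffineMap.const ℝ _ fun _ => b

@[simp]
theorem scaleShift_apply (a b : ℝ) (v : X → ℝ) (x : X) : scaleShift X a b v x = a * v x + b := rfl

variable {Z : Type*} [AddCommGroup Z] [Module ℝ Z] [Fintype X]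

/-- Sum pooling in the direction `z`: the linear readout `w ↦ (∑ x, w x) • z`. -/
def sumLayer (X : Type*) [Fintype X] (z : Z) : (X → ℝ) →ᵃ[ℝ] Z :=
  (Fintype.linearCombination ℝ fun _ => z).toAffineMap

@[simp]
theorem sumLayer_apply (z : Z) (w : X → ℝ) : sumLayer X z w = (∑ x, w x) • z := by
  simp [sumLayer, Fintype.linearCombination_apply, Finset.sum_smul]

theorem sumLayer_mem_equivAff {τ : Representation ℝ G Z} {z : Z} (hz : ∀ g, τ g z = z) :
    sumLayer X z ∈ equivAff (permRep G X) τ := fun g v => by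
  rw [sumLayer_apply, sum_permRep, sumLayer_apply, map_smul, hz]

end Permutations

theorem convLayer_mono (n : ℕ) : Monotone (convLayer n) := by
  rintro k l hkl f ⟨x, y, hf⟩
  refine ⟨fun i => if i.val < k then x i else 0, y, fun v => ?_⟩
  rw [hf]
  congr 1
  simp only [Finset.sum_filter, ite_smul, zero_smul]
  refine Finset.sum_congr rfl fun i _ => ?_
  split_ifs <;> first | rfl | omega

theorem mem_convLayer_one_iff {n : ℕ} {f : (Fin n → ℝ) →ᵃ[ℝ] (Fin n → ℝ)} :
    f ∈ convLayer n 1 ↔ ∃ a b, f = scaleShift (Fin n) a b := by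
  rcases n with _ | n
  · exact iff_of_true ⟨0, 0, fun v => Subsingleton.elim _ _⟩
      ⟨0, 0, AffineMap.ext fun v => Subsingleton.elim _ _⟩
  have hfilter : ({i | i.val < 1} : Finset (Fin (n + 1))) = {0} := by
    ext i
    simp [← Fin.val_eq_zero_iff]
  have hconv : ∀ (x : Fin (n + 1) → ℝ) (y : ℝ) (v : Fin (n + 1) → ℝ),
      (∑ i : Fin (n + 1) with i.val < 1,
        x i • (Matrix.circulant (Pi.single i (1 : ℝ))).mulVec v) + y • (1 : Fin (n + 1) → ℝ) =
      scaleShift _ (x 0) y v := fun x y v => by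
    rw [hfilter, Finset.sum_singleton, Matrix.circulant_single_one, Matrix.one_mulVec]
    ext i
    simp
  constructor
  · rintro ⟨x, y, hf⟩
    exact ⟨x 0, y, AffineMap.ext fun v => (hf v).trans (hconv x y v)⟩
  · rintro ⟨a, b, rfl⟩
    exact ⟨fun _ => a, b, fun v => (hconv (fun _ => a) b v).symm⟩

theorem scaleShift_mem_convLayer (n : ℕ) {k : ℕ} (hk : 1 ≤ k) (a b : ℝ) :
    scaleShift (Fin n) a b ∈ convLayer n k :=
  convLayer_mono n hk (mem_convLayer_one_iff.2 ⟨a, b, rfl⟩)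

theorem convLayer_one_le_symAff (n : ℕ) : convLayer n 1 ≤ symAff n (Fin n) (Fin n) := by
  intro f hf
  obtain ⟨a, b, rfl⟩ := mem_convLayer_one_iff.1 hf
  exact fun _ _ => rfl

instance isPretransitive_cyclicShifts (n : ℕ) :
    MulAction.IsPretransitive (cyclicShifts n) (Fin n) := by
  rcases lt_or_ge n 2 with hn | hn
  · have : Subsingleton (Fin n) := Fin.subsingleton_iff_le_one.2 (by omega)
    exact ⟨fun i j => ⟨1, Subsingleton.elim _ _⟩⟩
  · obtain ⟨m, rfl⟩ := Nat.exists_eq_add_of_le' hn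
    refine ⟨fun i j => ?_⟩
    obtain ⟨l, hl⟩ := isCycle_finRotate.exists_zpow_eq (x := i) (y := j) (by simp) (by simp)
    exact ⟨⟨finRotate (m + 2) ^ l, l, rfl⟩, hl⟩

theorem invLayer_eq_symInv (n : ℕ) : invLayer n = symInv n (Fin n) := by
  ext f
  exact mem_equivAff_trivial_iff.trans mem_equivAff_trivial_iff.symm

end Layers

section Separation

section SepRel

variable {X Z : Type*} [TopologicalSpace X] [TopologicalSpace Z] {A B C : Set C(X, Z)}

theorem sepRel_anti (h : A ⊆ B) : sepRel B ⊆ sepRel A := fun _ hp f hf => hp f (h hf)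

theorem sepRel_closure [T2Space Z] (A : Set C(X, Z)) : sepRel (closure A) = sepRel A := by
  refine (sepRel_anti subset_closure).antisymm fun p hp f hf => ?_
  have hclosed : IsClosed {f : C(X, Z) | f p.1 = f p.2} :=
    isClosed_eq (continuous_eval_const _) (continuous_eval_const _)
  exact closure_minimal hp hclosed hf

theorem sepRel_eq_of_subset_of_subset (hAB : A ⊆ B) (hBC : B ⊆ C) (h : sepRel A ⊆ sepRel C) :
    sepRel A = sepRel B ∧ sepRel B = sepRel C :=
  ⟨(h.trans (sepRel_anti hBC)).antisymm (sepRel_anti hAB),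
    ((sepRel_anti hAB).trans h).antisymm (sepRel_anti hBC)⟩

theorem not_isSepUniversal_of_ssubset [T2Space Z] (h : closure A ⊂ B)
    (hsep : sepRel (closure A) = sepRel B) : ¬ IsSepUniversal A := by
  intro hA
  refine h.2 fun f hf => hA.ge fun p hp => ?_
  rw [← sepRel_closure, hsep] at hp
  exact hp f hf

end SepRel

theorem IsUniversalActivation.clm_ext {E : Type*} [AddCommGroup E] [Module ℝ E]
    [TopologicalSpace E] [T2Space E] {s : C(ℝ, ℝ)} (hs : IsUniversalActivation s)
    {L L' : C(ℝ, ℝ) →L[ℝ] E} (h : ∀ a b, L (dilate s a b) = L' (dilate s a b)) : L = L' :=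
  ContinuousLinearMap.ext_on hs (Set.forall_mem_range.2 fun p => h p.1 p.2)

/-- Urysohn functions count how often each value is taken. -/
theorem exists_perm_of_forall_sum_eq {X T : Type*} [Fintype X] [TopologicalSpace T] [T1Space T]
    [NormalSpace T] {u v : X → T} (h : ∀ f : C(T, ℝ), ∑ x, f (u x) = ∑ x, f (v x)) :
    ∃ π : Equiv.Perm X, ∀ x, v (π x) = u x := by
  classical
  have hcard : ∀ c, Fintype.card {x // u x = c} = Fintype.card {x // v x = c} := fun c => by
    obtain ⟨f, hf, hfc, -⟩ := exists_continuous_zero_one_of_isClosed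
      (s := (Set.range u ∪ Set.range v) \ {c}) (t := {c})
      (((Set.finite_range u).union (Set.finite_range v)).sdiff).isClosed isClosed_singleton
      Set.disjoint_sdiff_left
    have hsum : ∀ w : X → T, Set.range w ⊆ Set.range u ∪ Set.range v →
        ∑ x, f (w x) = Fintype.card {x // w x = c} := fun w hw => by
      rw [Fintype.card_subtype, Finset.natCast_card_filter]
      refine Finset.sum_congr rfl fun x _ => ?_
      split_ifs with hx
      · exact hfc hx
      · exact hf ⟨hw ⟨x, rfl⟩, hx⟩
    have hf := h f
    rw [hsum u Set.subset_union_left, hsum v Set.subset_union_right] at hf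
    exact_mod_cast hf
  exact ⟨Equiv.ofFiberEquiv fun c => Fintype.equivOfCardEq (hcard c), fun x =>
    Equiv.ofFiberEquiv_map _ x⟩

variable {X : Type*} {s : C(ℝ, ℝ)} {M : Submodule ℝ ((X → ℝ) →ᵃ[ℝ] (X → ℝ))}

theorem exists_perm_of_mem_sepRel_networks [Fintype X] {Z : Type*} [AddCommGroup Z] [Module ℝ Z]
    [TopologicalSpace Z] [IsTopologicalAddGroup Z] [ContinuousSMul ℝ Z] {z : Z}
    {N : Submodule ℝ ((X → ℝ) →ᵃ[ℝ] Z)} (hs : IsUniversalActivation s)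
    (hM : ∀ a b, scaleShift X a b ∈ M) (hz : z ≠ 0) (hN : sumLayer X z ∈ N)
    {p : (X → ℝ) × (X → ℝ)} (hp : p ∈ sepRel (networks s M N)) :
    ∃ g : Equiv.Perm X, permRep (Equiv.Perm X) X g p.1 = p.2 := by
  let sumEval (u : X → ℝ) : C(ℝ, ℝ) →L[ℝ] ℝ := ∑ x, ContinuousMap.evalCLM ℝ (u x)
  have hsum : sumEval p.2 = sumEval p.1 := hs.clm_ext fun a b => by
    let neuron : C(X → ℝ, ℝ) := ⟨fun v => ∑ x, dilate s a b (v x), by fun_prop⟩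
    have hneuron : smulConst z neuron ∈ networks s M N :=
      mem_networks_of_eq (hM a b) hN fun v => by simp [neuron, pointwise]
    have h := smul_left_injective ℝ hz (hp _ hneuron)
    simpa [sumEval, neuron] using h.symm
  obtain ⟨π, hπ⟩ := exists_perm_of_forall_sum_eq fun f => by
    simpa [sumEval] using DFunLike.congr_fun hsum f
  exact ⟨π⁻¹, funext fun x => by rw [permRep_apply, inv_inv]; exact hπ x⟩

theorem eq_of_mem_sepRel_networks {N : Submodule ℝ ((X → ℝ) →ᵃ[ℝ] (X → ℝ))}
    (hs : IsUniversalActivation s) (hM : ∀ a b, scaleShift X a b ∈ M)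
    (hN : scaleShift X 1 0 ∈ N) {p : (X → ℝ) × (X → ℝ)} (hp : p ∈ sepRel (networks s M N)) :
    p.1 = p.2 := by
  funext x
  have heval : ContinuousMap.evalCLM ℝ (p.1 x) = ContinuousMap.evalCLM ℝ (p.2 x) :=
    hs.clm_ext fun a b => by
      have hneuron := hp ⟨fun v x => dilate s a b (v x), by fun_prop⟩
        (mem_networks_of_eq (hM a b) hN fun v => by ext; simp [pointwise])
      exact congrFun hneuron x
  exact DFunLike.congr_fun heval (ContinuousMap.id ℝ)

end Separation

section Obstructions

section IndexSet

variable {X Z : Type*} [AddCommGroup Z] [Module ℝ Z] [TopologicalSpace Z]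
  [IsTopologicalAddGroup Z] [ContinuousSMul ℝ Z] {N : Submodule ℝ ((X → ℝ) →ᵃ[ℝ] Z)}

theorem smulConst_comp_sum_mem_universalityClass [Fintype X] [Nonempty X] {G : Type*} [Group G]
    [MulAction G X] {s : C(ℝ, ℝ)} (hs : IsUniversalActivation s) {z : Z} (hN : sumLayer X z ∈ N)
    (f : C(ℝ, ℝ)) :
    smulConst z (f.comp ⟨fun v : X → ℝ => ∑ x, v x, by fun_prop⟩) ∈
      universalityClass s (equivAff (permRep G X) (permRep G X)) N := by
  let L : C(ℝ, ℝ) →L[ℝ] C(X → ℝ, Z) :=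
    (smulConst z).comp (ContinuousMap.compCLM ℝ ℝ ⟨fun v : X → ℝ => ∑ x, v x, by fun_prop⟩)
  let S := (networksSubmodule s (equivAff (permRep G X) (permRep G X)) N).topologicalClosure
  have hneuron : ∀ a b, L (dilate s a b) ∈ S := fun a b => by
    have hfirst : sumLayer X (fun _ : X => a) + AffineMap.const ℝ _ (fun _ => b) ∈
        equivAff (permRep G X) (permRep G X) :=
      add_mem (sumLayer_mem_equivAff fun _ => rfl) fun _ _ => rfl
    refine Submodule.le_topologicalClosure _ (mem_networks_of_eq hfirst
      (N.smul_mem (Fintype.card X : ℝ)⁻¹ hN) fun v => ?_)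
    simp [L, pointwise, smul_smul, mul_comm a]
  exact Submodule.eq_top_iff'.1 (hs.eq_top (S := S.comap (L : C(ℝ, ℝ) →ₗ[ℝ] C(X → ℝ, Z)))
    ((Submodule.isClosed_topologicalClosure _).preimage L.continuous) hneuron) f

variable [T2Space Z] {σ : ℝ → ℝ}

theorem add_eq_of_mem_universalityClass_scaleShift {M : Submodule ℝ ((X → ℝ) →ᵃ[ℝ] (X → ℝ))}
    (hM : ∀ f ∈ M, ∃ a b, f = scaleShift X a b) {F : C(X → ℝ, Z)}
    (hF : F ∈ universalityClass σ M N) {u v : X → ℝ} (huv : ∀ x, u x = 0 ∨ v x = 0) :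
    F (u + v) + F 0 = F u + F v := by
  have h := sum_smul_eq_zero_of_mem_universalityClass ![1, 1, -1, -1] ![u + v, 0, u, v]
    (by simp [Fin.sum_univ_four]) (fun f hf => ?_) hF
  · simp only [Fin.sum_univ_four, Matrix.cons_val, one_smul, neg_smul, ← sub_eq_add_neg,
      sub_sub] at h
    exact sub_eq_zero.1 h
  · obtain ⟨a, b, rfl⟩ := hM f hf
    ext x
    rcases huv x with hx | hx <;> simp [Fin.sum_univ_four, pointwise, hx]

/-- Coordinate `x` of an equivariant first layer depends only on `v x` and on the sum of all
coordinates, so a signed measure of points with a common coordinate sum whose one-dimensional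
marginals vanish annihilates all networks with that layer. -/
theorem sum_smul_eq_zero_of_mem_universalityClass_perm [Fintype X] [Nonempty X] {ι : Type*}
    [Fintype ι] (w : ι → ℝ) (p : ι → X → ℝ) {t : ℝ} (ht : ∀ k, ∑ x, p k x = t)
    (hp : ∀ (φ : ℝ → ℝ) (x : X), ∑ k, w k * φ (p k x) = 0) {F : C(X → ℝ, Z)}
    (hF : F ∈ universalityClass σ
      (equivAff (permRep (Equiv.Perm X) X) (permRep (Equiv.Perm X) X)) N) :
    ∑ k, w k • F (p k) = 0 := by
  have hw : ∑ k, w k = 0 := by simpa using hp 1 (Classical.arbitrary X)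
  refine sum_smul_eq_zero_of_mem_universalityClass w p hw (fun f hf => ?_) hF
  obtain ⟨a, b, c, hf⟩ := mem_equivAff_perm_iff.1 hf
  ext x
  simpa [pointwise, hf, ht] using hp (fun r => σ (a * r + b * t + c)) x

end IndexSet

variable {Z : Type*} [AddCommGroup Z] [Module ℝ Z] [TopologicalSpace Z]
  [IsTopologicalAddGroup Z] [ContinuousSMul ℝ Z] [T2Space Z] {σ : ℝ → ℝ}

theorem sum_smul_append_eq_zero_of_mem_universalityClass_symAff {m k : ℕ} [NeZero m]
    {N : Submodule ℝ ((Fin (m + k) → ℝ) →ᵃ[ℝ] Z)} {ι : Type*} [Fintype ι] (w : ι → ℝ)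
    (a : ι → Fin m → ℝ) (r : Fin k → ℝ) {t : ℝ} (ht : ∀ κ, ∑ j, a κ j = t)
    (ha : ∀ (φ : ℝ → ℝ) (j : Fin m), ∑ κ, w κ * φ (a κ j) = 0) {F : C(Fin (m + k) → ℝ, Z)}
    (hF : F ∈ universalityClass σ (symAff (m + k) (Fin (m + k)) (Fin (m + k))) N) :
    ∑ κ, w κ • F (Fin.append (a κ) r) = 0 := by
  have hw : ∑ κ, w κ = 0 := by simpa using ha 1 0
  refine sum_smul_eq_zero_of_mem_universalityClass_perm w _ (t := t + ∑ j, r j)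
    (fun κ => by simp [Fin.sum_univ_add, ht]) (fun φ => Fin.addCases (fun j => ?_) fun j => ?_) hF
  · simpa using ha φ j
  · simp [← Finset.sum_mul, hw]

theorem smulConst_sumPow_notMem_universalityClass {n : ℕ} (hn : 1 < n) {z : Z} (hz : z ≠ 0)
    {N : Submodule ℝ ((Fin n → ℝ) →ᵃ[ℝ] Z)} :
    smulConst z (sumPow n) ∉ universalityClass σ (convLayer n 1) N := by
  intro h
  have hadd := add_eq_of_mem_universalityClass_scaleShift (fun _ => mem_convLayer_one_iff.1) h
    (u := Pi.single ⟨0, by omega⟩ 1) (v := Pi.single ⟨1, hn⟩ 1) fun i => by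
      by_cases hi : i = ⟨1, hn⟩ <;> simp [hi]
  simp only [smulConst_apply, ← add_smul] at hadd
  have hpow := smul_left_injective ℝ hz hadd
  have hn0 : n ≠ 0 := by omega
  simp only [sumPow, ContinuousMap.coe_mk, Pi.add_apply, Finset.sum_add_distrib, Pi.zero_apply,
    Finset.sum_const_zero, Finset.sum_pi_single', Finset.mem_univ, if_true, zero_pow hn0,
    one_pow, add_zero] at hpow
  have hlt : (1 + 1 : ℝ) ^ 1 < (1 + 1) ^ n := pow_lt_pow_right₀ (by norm_num) hn
  linarith

/-- The invariant polynomial `(x₁² + ⋯ + x_n²)³`, which separates PointNets from networks with a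
regular hidden representation for every `n > 2`. Degree six is needed for `n = 3`: once
`x₁ + x₂ + x₃` is fixed, every symmetric polynomial of degree at most five is a linear combination
of power sums. -/
def sumSqCubed (n : ℕ) : C(Fin n → ℝ, ℝ) := ⟨fun x => (∑ i, x i ^ 2) ^ 3, by fun_prop⟩

theorem smulConst_sumSqCubed_notMem_universalityClass {n : ℕ} (hn : 2 < n) {z : Z} (hz : z ≠ 0)
    {N : Submodule ℝ ((Fin n → ℝ) →ᵃ[ℝ] Z)} :
    smulConst z (sumSqCubed n) ∉ universalityClass σ (symAff n (Fin n) (Fin n)) N := by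
  obtain ⟨k, rfl⟩ : ∃ k, n = 3 + k := ⟨n - 3, by omega⟩
  intro h
  have hsum := sum_smul_append_eq_zero_of_mem_universalityClass_symAff
    ![1, 1, 1, -1, -1, -1]
    ![![0, 2, 4], ![1, 3, 2], ![2, 1, 3], ![0, 3, 3], ![1, 1, 4], ![2, 2, 2]] 0 (t := 6)
    (fun κ => by fin_cases κ <;> simp [Fin.sum_univ_three] <;> norm_num)
    (fun φ j => by fin_cases j <;> simp [Fin.sum_univ_six] <;> ring) h
  simp only [smulConst_apply, smul_smul, ← Finset.sum_smul] at hsum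
  have hzero := (smul_eq_zero.1 hsum).resolve_right hz
  have happend : ∀ a : Fin 3 → ℝ,
      sumSqCubed (3 + k) (Fin.append a 0) = (a 0 ^ 2 + a 1 ^ 2 + a 2 ^ 2) ^ 3 := fun a => by
    simp [sumSqCubed, Fin.sum_univ_add, Fin.sum_univ_three]
  simp only [happend, Fin.sum_univ_six, Matrix.cons_val] at hzero
  norm_num at hzero

theorem coordProd_notMem_universalityClass {n : ℕ} (hn : 3 < n)
    {N : Submodule ℝ ((Fin n → ℝ) →ᵃ[ℝ] ℝ)} :
    coordProd n ∉ universalityClass σ (symAff n (Fin n) (Fin n)) N := by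
  obtain ⟨k, rfl⟩ : ∃ k, n = 4 + k := ⟨n - 4, by omega⟩
  intro h
  have hsum := sum_smul_append_eq_zero_of_mem_universalityClass_symAff ![1, 1, -1, -1]
    ![![1, -1, 1, -1], 0, ![1, -1, 0, 0], ![0, 0, 1, -1]] 1 (t := 0)
    (fun κ => by fin_cases κ <;> simp [Fin.sum_univ_four])
    (fun φ j => by fin_cases j <;> simp [Fin.sum_univ_four]) h
  simp [coordProd, Fin.prod_univ_add, Fin.sum_univ_four, Fin.prod_univ_four] at hsum

end Obstructions

section Comparison

section Invariance

variable {n : ℕ}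

theorem sumPow_permRep {G : Type*} [Group G] [MulAction G (Fin n)] (g : G) (v : Fin n → ℝ) :
    sumPow n (permRep G (Fin n) g v) = sumPow n v :=
  congrArg (· ^ n) (sum_permRep g v)

theorem sumSqCubed_permRep {G : Type*} [Group G] [MulAction G (Fin n)] (g : G) (v : Fin n → ℝ) :
    sumSqCubed n (permRep G (Fin n) g v) = sumSqCubed n v :=
  congrArg (· ^ 3) (Equiv.sum_comp (MulAction.toPerm g⁻¹) fun i => v i ^ 2)

theorem coordProd_permRep {G : Type*} [Group G] [MulAction G (Fin n)] (g : G) (v : Fin n → ℝ) :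
    coordProd n (permRep G (Fin n) g v) = coordProd n v :=
  Equiv.prod_comp (MulAction.toPerm g⁻¹) v

end Invariance

section Readout

variable {n : ℕ} {Z : Type*} [AddCommGroup Z] [Module ℝ Z] [TopologicalSpace Z]
  [IsTopologicalAddGroup Z] [ContinuousSMul ℝ Z] {s : C(ℝ, ℝ)} {z : Z}

theorem smulConst_sumPow_mem_universalityClass {N : Submodule ℝ ((Fin n → ℝ) →ᵃ[ℝ] Z)}
    (hs : IsUniversalActivation s) (hn : 0 < n) (hN : sumLayer (Fin n) z ∈ N) :
    smulConst z (sumPow n) ∈ universalityClass s (symAff n (Fin n) (Fin n)) N :=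
  have : NeZero n := ⟨hn.ne'⟩
  smulConst_comp_sum_mem_universalityClass hs hN ⟨(· ^ n), by fun_prop⟩

variable [T2Space Z]

theorem universalityClass_convLayer_ssubset {N N' : Submodule ℝ ((Fin n → ℝ) →ᵃ[ℝ] Z)}
    (hs : IsUniversalActivation s) (hn : 1 < n) (hz : z ≠ 0) (hN : sumLayer (Fin n) z ∈ N)
    (hN' : N' ≤ N) :
    universalityClass s (convLayer n 1) N' ⊂ universalityClass s (symAff n (Fin n) (Fin n)) N :=
  Set.ssubset_iff_exists.2 ⟨universalityClass_mono (convLayer_one_le_symAff n) hN', _,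
    smulConst_sumPow_mem_universalityClass hs (by omega) hN,
    smulConst_sumPow_notMem_universalityClass hn hz⟩

variable [FiniteDimensional ℝ Z] {τ : Representation ℝ (SymGroup n) Z}

theorem universalityClass_symAff_subset (hs : IsUniversalActivation s) :
    universalityClass s (symAff n (Fin n) (Fin n)) (equivAff (permRep (SymGroup n) (Fin n)) τ) ⊆
      universalityClass s (symAff n (Fin n) (SymGroup n))
        (equivAff (permRep (SymGroup n) (SymGroup n)) τ) := fun _ hF =>
  mem_universalityClass_of_map_rep hs (fun _ => LinearMap.continuous_of_finiteDimensional _)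
    (map_rep_of_mem_universalityClass (fun _ => LinearMap.continuous_of_finiteDimensional _)
      le_rfl le_rfl hF)

theorem universalityClass_symAff_ssubset (hs : IsUniversalActivation s) (hn : 2 < n) (hz : z ≠ 0)
    (hτ : ∀ g, τ g z = z) :
    universalityClass s (symAff n (Fin n) (Fin n)) (equivAff (permRep (SymGroup n) (Fin n)) τ) ⊂
      universalityClass s (symAff n (Fin n) (SymGroup n))
        (equivAff (permRep (SymGroup n) (SymGroup n)) τ) :=
  Set.ssubset_iff_exists.2 ⟨universalityClass_symAff_subset hs, smulConst z (sumSqCubed n),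
    mem_universalityClass_of_map_rep hs (fun _ => LinearMap.continuous_of_finiteDimensional _)
      fun g v => by simp [sumSqCubed_permRep, hτ],
    smulConst_sumSqCubed_notMem_universalityClass hn hz⟩

end Readout

section NotUniversal

variable {Z : Type*} [AddCommGroup Z] [Module ℝ Z] [TopologicalSpace Z]
  [IsTopologicalAddGroup Z] [ContinuousSMul ℝ Z] {z : Z}

theorem not_isEquivSepUniversal_of_smulConst_notMem {G V : Type*} [Group G] [AddCommGroup V]
    [Module ℝ V] [TopologicalSpace V] {ρ : Representation ℝ G V} {τ : Representation ℝ G Z}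
    {A : Set C(V, Z)} {f : C(V, ℝ)} (hf : ∀ g v, f (ρ g v) = f v) (hτ : ∀ g, τ g z = z)
    (hsep : ∀ p ∈ sepRel A, f p.1 = f p.2) (hA : smulConst z f ∉ closure A) :
    ¬ IsEquivSepUniversal ρ τ A := fun h =>
  hA (h.ge ⟨fun p hp => by simp [hsep p hp], fun g v => by simp [hf, hτ]⟩)

theorem not_isEquivSepUniversal_networks {X : Type*} [Finite X] {s : C(ℝ, ℝ)}
    {M : Submodule ℝ ((X → ℝ) →ᵃ[ℝ] (X → ℝ))} {τ : Representation ℝ (Equiv.Perm X) Z}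
    {f : C(X → ℝ, ℝ)} (hs : IsUniversalActivation s) (hM : ∀ a b, scaleShift X a b ∈ M)
    (hz : z ≠ 0) (hτ : ∀ g, τ g z = z) (hf : ∀ g v, f (permRep (Equiv.Perm X) X g v) = f v)
    (hfM : smulConst z f ∉ universalityClass s M (equivAff (permRep (Equiv.Perm X) X) τ)) :
    ¬ IsEquivSepUniversal (permRep (Equiv.Perm X) X) τ
      (networks s M (equivAff (permRep (Equiv.Perm X) X) τ)) := by
  cases nonempty_fintype X
  refine not_isEquivSepUniversal_of_smulConst_notMem hf hτ (fun p hp => ?_) hfM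
  obtain ⟨g, hg⟩ := exists_perm_of_mem_sepRel_networks hs hM hz (sumLayer_mem_equivAff hτ) hp
  rw [← hg, hf]

end NotUniversal

variable {n : ℕ} {s : C(ℝ, ℝ)}

section InvariantModels

theorem cnnClass_ssubset_pointNetClass (hs : IsUniversalActivation s) (hn : 1 < n) :
    cnnClass n s ⊂ pointNetClass n s :=
  universalityClass_convLayer_ssubset hs hn one_ne_zero (sumLayer_mem_equivAff fun _ => rfl)
    (invLayer_eq_symInv n).le

theorem pointNetClass_ssubset_regularClass (hs : IsUniversalActivation s) (hn : 2 < n) :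
    pointNetClass n s ⊂ regularClass n s :=
  universalityClass_symAff_ssubset hs hn one_ne_zero fun _ => rfl

theorem sepRel_invariantClasses_eq (hs : IsUniversalActivation s) :
    sepRel (cnnClass n s) = sepRel (pointNetClass n s) ∧
      sepRel (pointNetClass n s) = sepRel (regularClass n s) := by
  refine sepRel_eq_of_subset_of_subset
    (universalityClass_mono (convLayer_one_le_symAff n) (invLayer_eq_symInv n).le)
    (universalityClass_symAff_subset hs) fun p hp F hF => ?_
  rw [cnnClass, universalityClass, sepRel_closure, invLayer_eq_symInv] at hp
  obtain ⟨g, hg⟩ := exists_perm_of_mem_sepRel_networks hs (scaleShift_mem_convLayer n le_rfl)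
    one_ne_zero (sumLayer_mem_equivAff fun _ => rfl) hp
  rw [← hg]
  exact (map_rep_of_mem_universalityClass (fun _ => continuous_id) le_rfl le_rfl hF g p.1).symm

theorem sumPow_mem_pointNetClass (hs : IsUniversalActivation s) (hn : 0 < n) :
    sumPow n ∈ pointNetClass n s := by
  rw [← smulConst_one (sumPow n)]
  exact smulConst_sumPow_mem_universalityClass hs hn (sumLayer_mem_equivAff fun _ => rfl)

theorem sumPow_notMem_cnnClass {σ : ℝ → ℝ} (hn : 1 < n) : sumPow n ∉ cnnClass n σ := by
  rw [← smulConst_one (sumPow n)]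
  exact smulConst_sumPow_notMem_universalityClass hn one_ne_zero

theorem coordProd_mem_regularClass (hs : IsUniversalActivation s) :
    coordProd n ∈ regularClass n s :=
  mem_universalityClass_of_map_rep hs (fun _ => LinearMap.continuous_of_finiteDimensional _)
    coordProd_permRep

theorem not_isSepUniversal_cnn (hs : IsUniversalActivation s) (hn : 1 < n) :
    ¬ IsSepUniversal (networks s (convLayer n 1) (invLayer n)) :=
  not_isSepUniversal_of_ssubset (cnnClass_ssubset_pointNetClass hs hn)
    (sepRel_invariantClasses_eq hs).1

theorem not_isSepUniversal_pointNet (hs : IsUniversalActivation s) (hn : 2 < n) :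
    ¬ IsSepUniversal (networks s (symAff n (Fin n) (Fin n)) (symInv n (Fin n))) :=
  not_isSepUniversal_of_ssubset (pointNetClass_ssubset_regularClass hs hn)
    (sepRel_invariantClasses_eq hs).2

end InvariantModels

section EquivariantModels

theorem cnnEquivClass_ssubset_pointNetEquivClass (hs : IsUniversalActivation s) (hn : 1 < n) :
    cnnEquivClass n 1 s ⊂ pointNetEquivClass n (Fin n) s :=
  have : NeZero n := ⟨by omega⟩
  universalityClass_convLayer_ssubset (z := (1 : Fin n → ℝ)) hs hn one_ne_zero
    (sumLayer_mem_equivAff fun _ => rfl) (convLayer_one_le_symAff n)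

theorem pointwiseEquivClass_ssubset_pointNetEquivClass {Y : Type*} [Nonempty Y]
    [MulAction (SymGroup n) Y] (hs : IsUniversalActivation s) (hn : 1 < n) :
    pointwiseEquivClass n Y s ⊂ pointNetEquivClass n Y s :=
  universalityClass_convLayer_ssubset (z := (1 : Y → ℝ)) hs hn one_ne_zero
    (sumLayer_mem_equivAff fun _ => rfl) le_rfl

theorem pointNetEquivClass_ssubset_regularEquivClass {Y : Type*} [Finite Y] [Nonempty Y]
    [MulAction (SymGroup n) Y] (hs : IsUniversalActivation s) (hn : 2 < n) :
    pointNetEquivClass n Y s ⊂ regularEquivClass n Y s :=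
  universalityClass_symAff_ssubset (z := (1 : Y → ℝ)) hs hn one_ne_zero fun _ => rfl

theorem sepRel_equivClasses_eq (hs : IsUniversalActivation s) :
    sepRel (cnnEquivClass n 1 s) = sepRel (pointNetEquivClass n (Fin n) s) ∧
      sepRel (pointNetEquivClass n (Fin n) s) = sepRel (regularEquivClass n (Fin n) s) := by
  refine sepRel_eq_of_subset_of_subset
    (universalityClass_mono (convLayer_one_le_symAff n) (convLayer_one_le_symAff n))
    (universalityClass_symAff_subset hs) fun p hp F _ => ?_
  rw [cnnEquivClass, universalityClass, sepRel_closure] at hp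
  rw [eq_of_mem_sepRel_networks hs (scaleShift_mem_convLayer n le_rfl)
    (scaleShift_mem_convLayer n le_rfl 1 0) hp]

theorem not_isEquivSepUniversal_cnn {k : ℕ} (hs : IsUniversalActivation s) (hn : 1 < n)
    (hk : 1 ≤ k) :
    ¬ IsEquivSepUniversal (permRep (cyclicShifts n) (Fin n)) (permRep (cyclicShifts n) (Fin n))
      (networks s (convLayer n 1) (convLayer n k)) :=
  have : NeZero n := ⟨by omega⟩
  not_isEquivSepUniversal_of_smulConst_notMem (z := (1 : Fin n → ℝ)) sumPow_permRep
    (fun _ => rfl)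
    (fun _ hp => congrArg (sumPow n) <| eq_of_mem_sepRel_networks hs
      (scaleShift_mem_convLayer n le_rfl) (scaleShift_mem_convLayer n hk 1 0) hp)
    (smulConst_sumPow_notMem_universalityClass hn one_ne_zero)

theorem not_isEquivSepUniversal_pointwise {Y : Type*} [Nonempty Y] [MulAction (SymGroup n) Y]
    (hs : IsUniversalActivation s) (hn : 1 < n) :
    ¬ IsEquivSepUniversal (permRep (SymGroup n) (Fin n)) (permRep (SymGroup n) Y)
      (networks s (convLayer n 1) (symAff n (Fin n) Y)) :=
  not_isEquivSepUniversal_networks (z := (1 : Y → ℝ)) hs (scaleShift_mem_convLayer n le_rfl)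
    one_ne_zero (fun _ => rfl) sumPow_permRep
    (smulConst_sumPow_notMem_universalityClass hn one_ne_zero)

theorem not_isEquivSepUniversal_pointNet {Y : Type*} [Nonempty Y] [MulAction (SymGroup n) Y]
    (hs : IsUniversalActivation s) (hn : 2 < n) :
    ¬ IsEquivSepUniversal (permRep (SymGroup n) (Fin n)) (permRep (SymGroup n) Y)
      (networks s (symAff n (Fin n) (Fin n)) (symAff n (Fin n) Y)) :=
  not_isEquivSepUniversal_networks (z := (1 : Y → ℝ)) hs
    (fun a b => convLayer_one_le_symAff n (scaleShift_mem_convLayer n le_rfl a b))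
    one_ne_zero (fun _ => rfl) sumSqCubed_permRep
    (smulConst_sumSqCubed_notMem_universalityClass hn one_ne_zero)

end EquivariantModels

end Comparison

end EquivariantNetworks

theorem mainTheorem2 (n : ℕ) (hn : 2 < n) (σ : ℝ → ℝ) (hσ : Continuous σ)
    (hpoly : ¬ ∃ p : Polynomial ℝ, ∀ t, σ t = p.eval t) :
    -- invariant models
    ((sepRel (cnnClass n σ) = sepRel (pointNetClass n σ) ∧
        sepRel (pointNetClass n σ) = sepRel (regularClass n σ)) ∧
      (cnnClass n σ ⊂ pointNetClass n σ ∧ pointNetClass n σ ⊂ regularClass n σ) ∧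
      (sumPow n ∈ pointNetClass n σ ∧ sumPow n ∉ cnnClass n σ) ∧
      (3 < n → coordProd n ∈ regularClass n σ ∧ coordProd n ∉ pointNetClass n σ) ∧
      ¬ IsSepUniversal (networks σ (convLayer n 1) (invLayer n)) ∧
      ¬ IsSepUniversal (networks σ (symAff n (Fin n) (Fin n)) (symInv n (Fin n)))) ∧
    -- equivariant models with output `ℝⁿ`
    ((sepRel (cnnEquivClass n 1 σ) = sepRel (pointNetEquivClass n (Fin n) σ) ∧
        sepRel (pointNetEquivClass n (Fin n) σ) = sepRel (regularEquivClass n (Fin n) σ)) ∧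
      (cnnEquivClass n 1 σ ⊂ pointNetEquivClass n (Fin n) σ ∧
        pointNetEquivClass n (Fin n) σ ⊂ regularEquivClass n (Fin n) σ) ∧
      (∀ k : ℕ, 1 ≤ k → k ≤ n →
        ¬ IsEquivSepUniversal (permRep (cyclicShifts n) (Fin n))
          (permRep (cyclicShifts n) (Fin n)) (networks σ (convLayer n 1) (convLayer n k)))) ∧
    -- equivariant models with output an arbitrary nonzero permutation representation `ℝ^Y` of `S_n`
    (∀ (Y : Type*) [Finite Y] [Nonempty Y] [MulAction (SymGroup n) Y],
      (pointwiseEquivClass n Y σ ⊂ pointNetEquivClass n Y σ ∧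
        pointNetEquivClass n Y σ ⊂ regularEquivClass n Y σ) ∧
      ¬ IsEquivSepUniversal (permRep (SymGroup n) (Fin n)) (permRep (SymGroup n) Y)
        (networks σ (convLayer n 1) (symAff n (Fin n) Y)) ∧
      ¬ IsEquivSepUniversal (permRep (SymGroup n) (Fin n)) (permRep (SymGroup n) Y)
        (networks σ (symAff n (Fin n) (Fin n)) (symAff n (Fin n) Y))) := by
  lift σ to C(ℝ, ℝ) using hσ
  have hs : IsUniversalActivation σ := isUniversalActivation_of_not_polynomial hpoly
  have h1 : 1 < n := by omega
  have : NeZero n := ⟨by omega⟩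
  exact ⟨⟨sepRel_invariantClasses_eq hs,
      ⟨cnnClass_ssubset_pointNetClass hs h1, pointNetClass_ssubset_regularClass hs hn⟩,
      ⟨sumPow_mem_pointNetClass hs (by omega), sumPow_notMem_cnnClass h1⟩,
      fun h3 => ⟨coordProd_mem_regularClass hs, coordProd_notMem_universalityClass h3⟩,
      not_isSepUniversal_cnn hs h1, not_isSepUniversal_pointNet hs hn⟩,
    ⟨sepRel_equivClasses_eq hs,
      ⟨cnnEquivClass_ssubset_pointNetEquivClass hs h1,
        pointNetEquivClass_ssubset_regularEquivClass hs hn⟩,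
      fun _ hk _ => not_isEquivSepUniversal_cnn hs h1 hk⟩,
    fun _ _ _ _ => ⟨⟨pointwiseEquivClass_ssubset_pointNetEquivClass hs h1,
        pointNetEquivClass_ssubset_regularEquivClass hs hn⟩,
      not_isEquivSepUniversal_pointwise hs h1, not_isEquivSepUniversal_pointNet hs hn⟩⟩
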